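/- Let $K$ be a complex Hilbert space, $N\ge 2$, and let $(K,V_i)_{i=0}^{N-1}$ be a row co-isometry, i.e. the $V_i$ are bounded operators on $K$ with $\sum_{i=0}^{N-1}V_iV_i^*=I_K$. Let $(H,S_i)_{i=0}^{N-1}$ be its Cuntz dilation: $H\supseteq K$ is a Hilbert space carrying bounded operators $S_i$ with $S_i^*S_j=\delta_{ij}I$, $\sum_i S_iS_i^*=I$, such that $S_i^*K\subseteq K$ and $S_i^*|_K=V_i^*$ for all $i$, and $K$ is cyclic, i.e. the only closed subspace of $H$ that contains $K$ and is invariant under all $S_i$ and $S_i^*$ is $H$. Let $\mathcal T$ be a complete metric space and let $e:\mathcal T\to K$, $t\mapsto e_t$, be a continuous map with $\|e_t\|=1$ for all $t$ and with $\overline{\operatorname{span}}\{e_t:t\in\mathcal T\}=K$. Suppose that there are functions $\nu_i:\mathcal T\to\mathbb C$ and maps $g_i:\mathcal T\to\mathcal T$ such that $$V_i^*e_t=\nu_i(t)\,e_{g_i(t)}\qquad(t\in\mathcal T,\ 0\le i\le N-1),$$ and each $g_i$ is a contraction (Lipschitz with some constant $<1$). Call $M\subseteq\mathcal T$ invariant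 if $g_i(t)\in M$ whenever $t\in M$ and $\nu_i(t)\ne0$. A minimal compact invariant set is a non-empty compact invariant set that contains no strictly smaller non-empty compact invariant set. For a word $\omega=\omega_1\cdots\omega_n$ (possibly empty) with letters in $\{0,\dots,N-1\}$ put $S_\omega=S_{\omega_1}\cdots S_{\omega_n}$, and for an invariant set $M$ put $$K(M)=\overline{\operatorname{span}}\{e_t:t\in M\}\subseteq K,\qquad H(M)=\overline{\operatorname{span}}\{S_\omega e_t:t\in M,\ \omega\text{ a finite word}\}\subseteq H.$$ **Theorem.** There are only finitely many minimal compact invariant sets. Let $M_1,\dots,M_p$ be the complete list of them, without repetitions. Then: 1. each $K(M_j)$ is invariant under $V_i^*$ for all $i$; 2. each $H(M_j)$ is invariant for the representation, i.e. under all $S_i$ and all $S_i^*$; 3. the spaces $H(M_j)$ are mutually orthogonal and $\bigoplus_{j=1}^pH(M_j)=H$; 4. each subrepresentation $(S_i|_{H(M_j)})_i$ is irreducible: $H(M_j)\neq 0$, and its only closed subspaces invariant under all $S_i$ and $S_i^*$ are $0$ and $H(M_j)$; 5. for $j\ne k$ the subrepresentations on $H(M_j)$ and $H(M_k)$ are disjoint: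 the only bounded operator $W:H(M_j)\to H(M_k)$ that intertwines them, i.e. $WS_i=S_iW$ and $WS_i^*=S_i^*W$ on $H(M_j)$ for all $i$, is $W=0$. -/

import Mathlib

open scoped NNReal

namespace CuntzWalk

section Operators

variable {N : ℕ}
variable {E : Type*} [NormedAddCommGroup E] [InnerProductSpace ℂ E]
variable {F : Type*} [NormedAddCommGroup F] [InnerProductSpace ℂ F]

/-- A row co-isometry: `N ≥ 2` bounded operators on a Hilbert space with `∑ Vᵢ Vᵢ* = I`. -/
structure IsRowCoisometry [CompleteSpace E] (V : Fin N → E →L[ℂ] E) : Prop where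
  two_le : 2 ≤ N
  sum_comp_adjoint :
    ∑ i, (V i).comp (ContinuousLinearMap.adjoint (V i)) = ContinuousLinearMap.id ℂ E

/-- A representation of the Cuntz algebra `𝒪_N`, given by the images `Sᵢ` of its generators:
`Sᵢ* Sⱼ = δᵢⱼ I` and `∑ Sᵢ Sᵢ* = I`. -/
structure IsCuntzRep [CompleteSpace E] (S : Fin N → E →L[ℂ] E) : Prop where
  adjoint_comp_self :
    ∀ i, (ContinuousLinearMap.adjoint (S i)).comp (S i) = ContinuousLinearMap.id ℂ E
  adjoint_comp_of_ne :
    ∀ i j, i ≠ j → (ContinuousLinearMap.adjoint (S i)).comp (S j) = 0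
  sum_comp_adjoint :
    ∑ i, (S i).comp (ContinuousLinearMap.adjoint (S i)) = ContinuousLinearMap.id ℂ E

/-- The subspace `L` is invariant for the (`*`-)representation generated by the `Sᵢ`, that is,
invariant under all `Sᵢ` and all `Sᵢ*`. -/
def IsInvariantForRep [CompleteSpace E] (S : Fin N → E →L[ℂ] E) (L : Submodule ℂ E) : Prop :=
  ∀ i, ∀ x ∈ L, S i x ∈ L ∧ ContinuousLinearMap.adjoint (S i) x ∈ L

/-- The subrepresentation: the restrictions of the `Sᵢ` to an invariant subspace `L`. -/
def subRep [CompleteSpace E] (S : Fin N → E →L[ℂ] E) (L : Submodule ℂ E)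
    (hL : IsInvariantForRep S L) : Fin N → L →L[ℂ] L :=
  fun i => ((S i).comp L.subtypeL).codRestrict L (fun x => (hL i x x.2).1)

/-- Irreducibility: the space is non-zero, and the only closed subspaces that are invariant for
the representation are `0` and the whole space. -/
def IsIrreducibleRep [CompleteSpace E] (S : Fin N → E →L[ℂ] E) : Prop :=
  Nontrivial E ∧ ∀ L : Submodule ℂ E, IsClosed (L : Set E) → IsInvariantForRep S L →
    L = ⊥ ∨ L = ⊤

/-- Disjointness: there is no non-zero bounded operator `W` with `W Sᵢ = S'ᵢ W` and
`W Sᵢ* = S'ᵢ* W` for all `i`. -/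
def AreDisjointReps [CompleteSpace E] [CompleteSpace F]
    (S : Fin N → E →L[ℂ] E) (S' : Fin N → F →L[ℂ] F) : Prop :=
  ∀ W : E →L[ℂ] F,
    (∀ i, W.comp (S i) = (S' i).comp W) →
    (∀ i, W.comp (ContinuousLinearMap.adjoint (S i)) =
      (ContinuousLinearMap.adjoint (S' i)).comp W) →
    W = 0

/-- `(F, S)` is a Cuntz dilation of `(E, V)`, where `E` is embedded into `F` by the isometry `ι`:
the `Sᵢ` form a representation of the Cuntz algebra; `Sᵢ*` maps (the copy of) `E` into itself and
restricts there to `Vᵢ*`; and `E` is cyclic, i.e. the only closed subspace of `F` which contains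
`E` and is invariant for the representation is `F`. Taking adjoints in `Sᵢ* ι = ι Vᵢ*`
gives `Vᵢ = p Sᵢ` on `E`, with `p` the orthogonal projection onto `E`. -/
structure IsCuntzDilation [CompleteSpace E] [CompleteSpace F]
    (V : Fin N → E →L[ℂ] E) (ι : E →ₗᵢ[ℂ] F) (S : Fin N → F →L[ℂ] F) : Prop where
  isCuntzRep : IsCuntzRep S
  adjoint_apply : ∀ i k,
    ContinuousLinearMap.adjoint (S i) (ι k) = ι (ContinuousLinearMap.adjoint (V i) k)
  cyclic : ∀ L : Submodule ℂ F, IsClosed (L : Set F) → (∀ k, ι k ∈ L) →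
    IsInvariantForRep S L → L = ⊤

/-- `S_ω = S_{ω₁} ⋯ S_{ωₙ}` for a finite word `ω = ω₁ … ωₙ` (the identity for the empty word). -/
def wordOp (S : Fin N → E →L[ℂ] E) (ω : List (Fin N)) : E →L[ℂ] E :=
  (ω.map S).prod

end Operators

section Walk

variable {N : ℕ} {T : Type*}

/-- `e` is a continuous family of unit vectors with dense linear span, `Vᵢ* e_t = νᵢ(t) e_{gᵢ(t)}`,
and each `gᵢ` is a contraction (Lipschitz with some constant `< 1`). -/
structure IsContractiveWalk [MetricSpace T]
    {E : Type*} [NormedAddCommGroup E] [InnerProductSpace ℂ E] [CompleteSpace E]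
    (V : Fin N → E →L[ℂ] E) (e : T → E) (ν : Fin N → T → ℂ) (g : Fin N → T → T) : Prop where
  continuous : Continuous e
  norm_eq_one : ∀ t, ‖e t‖ = 1
  span_dense : (Submodule.span ℂ (Set.range e)).topologicalClosure = ⊤
  adjoint_apply : ∀ i t, ContinuousLinearMap.adjoint (V i) (e t) = ν i t • e (g i t)
  contracting : ∀ i, ∃ c : ℝ≥0, ContractingWith c (g i)

/-- `M` is invariant: it contains `gᵢ(t)` whenever `t ∈ M` and the transition `t → gᵢ(t)` is
possible through `i`, i.e. `νᵢ(t) ≠ 0`. -/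
def IsInvariantSet (ν : Fin N → T → ℂ) (g : Fin N → T → T) (M : Set T) : Prop :=
  ∀ t ∈ M, ∀ i, ν i t ≠ 0 → g i t ∈ M

/-- The minimal compact invariant sets: the minimal elements, for inclusion, among the non-empty
compact invariant sets. -/
def minimalCompactInvariantSets [TopologicalSpace T]
    (ν : Fin N → T → ℂ) (g : Fin N → T → T) : Set (Set T) :=
  {M | Minimal (fun A : Set T => A.Nonempty ∧ IsCompact A ∧ IsInvariantSet ν g A) M}

/-- `K(M)`: the closed linear span of the `e_t`, `t ∈ M`. -/
def spaceK {E : Type*} [NormedAddCommGroup E] [InnerProductSpace ℂ E]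
    (e : T → E) (M : Set T) : Submodule ℂ E :=
  (Submodule.span ℂ (e '' M)).topologicalClosure

/-- `H(M)`: the closed linear span of the `S_ω e_t`, with `t ∈ M` and `ω` a finite word; here
`f t` is the vector `e_t` seen in the space of the dilation. -/
def spaceH {F : Type*} [NormedAddCommGroup F] [InnerProductSpace ℂ F]
    (S : Fin N → F →L[ℂ] F) (f : T → F) (M : Set T) : Submodule ℂ F :=
  (Submodule.span ℂ {x | ∃ t ∈ M, ∃ ω : List (Fin N), x = wordOp S ω (f t)}).topologicalClosure

instance spaceH.completeSpace {F : Type*} [NormedAddCommGroup F] [InnerProductSpace ℂ F]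
    [CompleteSpace F] (S : Fin N → F →L[ℂ] F) (f : T → F) (M : Set T) :
    CompleteSpace (spaceH S f M) :=
  (Submodule.isClosed_topologicalClosure _).completeSpace_coe

end Walk

end CuntzWalk

namespace CuntzWalk

open ContinuousLinearMap Filter Topology
open scoped InnerProductSpace

/-! ### Minimal compact invariant sets -/

section InvariantSets

variable {N : ℕ} {T : Type*}

/-! Write f_t = ι e_t. Everything rests on the kernel ⟪X f_s, f_t⟫ for X commuting with all Sᵢ and
Sᵢ*. Since ∑ SᵢSᵢ* = 1, its value at (s, t) is the sum of its values at (gᵢ s, gᵢ t) with weights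
conj νᵢ(s) νᵢ(t), while ∑ |νᵢ|² = 1. On a product A × B of compact invariant sets, a nonzero maximum
of the modulus therefore passes to some (gᵢ s, gᵢ t). A maximizing pair at least distance then has s
= t, because gᵢ is a contraction. So the kernel vanishes on A × B once it vanishes on the diagonal
over A ∩ B (`inner_eq_zero`), and with it the form on H(A) × H(B) (`inner_apply_spaceH_eq_zero`).

For distinct, hence disjoint, minimal sets the diagonal condition is empty: X = 1 gives
orthogonality, and an intertwiner extended by zero gives disjointness. For a single minimal set, X =
P_L - c gives irreducibility, where c is the value of ‖P_L f_t‖², constant by the maximum principle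
(`exists_minimal_isMaxOn`). The same principle on compact orbit closures kills the projection
complementary to all H(M_j). Finiteness holds because all minimal sets lie in one compact orbit
closure, while unit vectors from distinct ones are orthogonal. -/

theorem exists_minimal_subset [TopologicalSpace T] [T2Space T]
    {ν : Fin N → T → ℂ} {g : Fin N → T → T} {A : Set T}
    (hne : A.Nonempty) (hc : IsCompact A) (hA : IsInvariantSet ν g A) :
    ∃ M ∈ minimalCompactInvariantSets ν g, M ⊆ A := by
  obtain ⟨M, hMA, hM⟩ := zorn_superset_nonempty
    {B : Set T | B.Nonempty ∧ IsCompact B ∧ IsInvariantSet ν g B} (by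
      intro c hcS hchain hcne
      refine ⟨⋂₀ c, ⟨?_, ?_, ?_⟩, fun s hs => Set.sInter_subset_of_mem hs⟩
      · have : Nonempty c := hcne.to_subtype
        exact IsCompact.nonempty_sInter_of_directed_nonempty_isCompact_isClosed
          (fun x hx y hy => (hchain.total hx hy).elim (fun h => ⟨x, hx, subset_rfl, h⟩)
            fun h => ⟨y, hy, h, subset_rfl⟩) (fun s hs => (hcS hs).1)
          (fun s hs => (hcS hs).2.1) (fun s hs => (hcS hs).2.1.isClosed)
      · obtain ⟨s, hs⟩ := hcne
        exact (hcS hs).2.1.of_isClosed_subset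
          (isClosed_sInter fun b hb => (hcS hb).2.1.isClosed) (Set.sInter_subset_of_mem hs)
      · intro t ht i hi s hs
        exact (hcS hs).2.2 t (ht s hs) i hi)
    A ⟨hne, hc, hA⟩
  exact ⟨M, hM, hMA⟩

theorem prop_of_minimal [TopologicalSpace T] {ν : Fin N → T → ℂ} {g : Fin N → T → T} {M : Set T}
    (hM : M ∈ minimalCompactInvariantSets ν g) :
    M.Nonempty ∧ IsCompact M ∧ IsInvariantSet ν g M :=
  (show Minimal (fun A : Set T => A.Nonempty ∧ IsCompact A ∧ IsInvariantSet ν g A) M from hM).prop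

theorem subset_of_minimal [TopologicalSpace T] {ν : Fin N → T → ℂ} {g : Fin N → T → T}
    {M A : Set T} (hM : M ∈ minimalCompactInvariantSets ν g)
    (hA : A.Nonempty ∧ IsCompact A ∧ IsInvariantSet ν g A) (h : A ⊆ M) : M ⊆ A :=
  (show Minimal (fun A : Set T => A.Nonempty ∧ IsCompact A ∧ IsInvariantSet ν g A) M from hM).le_of_le
    hA h

theorem IsInvariantSet.inter {ν : Fin N → T → ℂ} {g : Fin N → T → T} {A B : Set T}
    (hA : IsInvariantSet ν g A) (hB : IsInvariantSet ν g B) : IsInvariantSet ν g (A ∩ B) :=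
  fun t ht i hi => ⟨hA t ht.1 i hi, hB t ht.2 i hi⟩

theorem disjoint_of_minimal [TopologicalSpace T] [T2Space T]
    {ν : Fin N → T → ℂ} {g : Fin N → T → T} {A B : Set T}
    (hA : A ∈ minimalCompactInvariantSets ν g) (hB : B ∈ minimalCompactInvariantSets ν g)
    (hne : A ≠ B) : Disjoint A B := by
  rw [Set.disjoint_iff_inter_eq_empty]
  by_contra h
  have hP : (A ∩ B).Nonempty ∧ IsCompact (A ∩ B) ∧ IsInvariantSet ν g (A ∩ B) :=
    ⟨Set.nonempty_iff_ne_empty.2 h, (prop_of_minimal hA).2.1.inter (prop_of_minimal hB).2.1,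
      (prop_of_minimal hA).2.2.inter (prop_of_minimal hB).2.2⟩
  exact hne (((subset_of_minimal hA hP Set.inter_subset_left).trans Set.inter_subset_right).antisymm
    ((subset_of_minimal hB hP Set.inter_subset_right).trans Set.inter_subset_left))

end InvariantSets

/-! ### Compactness of orbit closures -/

section Orbits

variable {N : ℕ} {T : Type*}

/-- The orbit of `x` under the semigroup generated by the maps `g i`. -/
def orbit (g : Fin N → T → T) (x : T) : Set T :=
  Set.range fun ω : List (Fin N) => ω.foldr g x

theorem mem_orbit_self (g : Fin N → T → T) (x : T) : x ∈ orbit g x := ⟨[], rfl⟩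

theorem map_mem_orbit {g : Fin N → T → T} {x y : T} (i : Fin N) (hy : y ∈ orbit g x) :
    g i y ∈ orbit g x := by
  obtain ⟨ω, rfl⟩ := hy
  exact ⟨i :: ω, rfl⟩

variable [MetricSpace T]

theorem exists_uniform_lipschitz {g : Fin N → T → T}
    (hg : ∀ i, ∃ c : ℝ≥0, ContractingWith c (g i)) :
    ∃ c : ℝ, 0 ≤ c ∧ c < 1 ∧ ∀ i x y, dist (g i x) (g i y) ≤ c * dist x y := by
  choose c hc using hg
  refine ⟨(Finset.univ.sup c : ℝ≥0), NNReal.coe_nonneg _, ?_, fun i x y => ?_⟩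
  · have : Finset.univ.sup c < 1 := (Finset.sup_lt_iff (by simp)).2 fun i _ => (hc i).1
    exact_mod_cast this
  · refine ((hc i).2.dist_le_mul x y).trans (mul_le_mul_of_nonneg_right ?_ dist_nonneg)
    exact_mod_cast Finset.le_sup (f := c) (Finset.mem_univ i)

/-- The orbit is `x` together with its own images under the `g i`, so the images of a finite net,
with `x` added, form a net finer by the factor `c`. -/
theorem exists_finite_cover_orbit {g : Fin N → T → T} {c : ℝ} (hc0 : 0 ≤ c) (hc1 : c < 1)
    (hg : ∀ i x y, dist (g i x) (g i y) ≤ c * dist x y) (x : T) :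
    ∃ R : ℝ, 0 ≤ R ∧ ∀ n : ℕ, ∃ F : Set T, F.Finite ∧
      ∀ y ∈ orbit g x, ∃ z ∈ F, dist y z ≤ c ^ n * R := by
  obtain ⟨D, hD0, hD⟩ : ∃ D : ℝ, 0 ≤ D ∧ ∀ i, dist (g i x) x ≤ D :=
    ⟨∑ i, dist (g i x) x, Finset.sum_nonneg fun _ _ => dist_nonneg, fun i =>
      Finset.single_le_sum (f := fun i => dist (g i x) x) (fun _ _ => dist_nonneg)
        (Finset.mem_univ i)⟩
  have h1 : 0 < 1 - c := by linarith
  have hR : 0 ≤ D / (1 - c) := by positivity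
  -- The radius solves `c * R + D = R`, so each `g i` maps the ball of radius `R` about `x` into
  -- itself.
  refine ⟨D / (1 - c), hR, fun n => ?_⟩
  induction n with
  | zero =>
    refine ⟨{x}, Set.finite_singleton x, ?_⟩
    rintro _ ⟨ω, rfl⟩
    refine ⟨x, rfl, ?_⟩
    rw [pow_zero, one_mul]
    induction ω with
    | nil => simpa using hR
    | cons i ω ih =>
      have h2 := dist_triangle (g i (ω.foldr g x)) (g i x) x
      have h3 := hg i (ω.foldr g x) x
      have h4 := mul_le_mul_of_nonneg_left ih hc0
      have h5 : c * (D / (1 - c)) + D = D / (1 - c) := by field_simp; ring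
      have h6 := hD i
      simp only [List.foldr_cons] at *
      linarith
  | succ n ih =>
    obtain ⟨F, hF, hcov⟩ := ih
    refine ⟨insert x (⋃ i, g i '' F),
      (Set.finite_iUnion fun i => hF.image _).insert x, ?_⟩
    rintro _ ⟨ω, rfl⟩
    cases ω with
    | nil => exact ⟨x, Set.mem_insert _ _, by simpa using by positivity⟩
    | cons i ω =>
      obtain ⟨z, hz, hzd⟩ := hcov (ω.foldr g x) ⟨ω, rfl⟩
      refine ⟨g i z, Or.inr (Set.mem_iUnion.2 ⟨i, z, hz, rfl⟩), (hg i _ z).trans ?_⟩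
      rw [pow_succ', mul_assoc]
      exact mul_le_mul_of_nonneg_left hzd hc0

theorem isCompact_closure_orbit [CompleteSpace T] {g : Fin N → T → T}
    (hg : ∀ i, ∃ c : ℝ≥0, ContractingWith c (g i)) (x : T) :
    IsCompact (closure (orbit g x)) := by
  obtain ⟨c, hc0, hc1, hc⟩ := exists_uniform_lipschitz hg
  obtain ⟨R, hR, hcov⟩ := exists_finite_cover_orbit hc0 hc1 hc x
  refine TotallyBounded.isCompact_of_isClosed (TotallyBounded.closure ?_) isClosed_closure
  rw [Metric.totallyBounded_iff]
  intro ε hε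
  have hlim : Tendsto (fun n : ℕ => c ^ n * R) atTop (𝓝 0) := by
    simpa using (tendsto_pow_atTop_nhds_zero_of_lt_one hc0 hc1).mul_const R
  obtain ⟨n, hn⟩ := (hlim.eventually (gt_mem_nhds hε)).exists
  obtain ⟨F, hF, hFc⟩ := hcov n
  refine ⟨F, hF, fun y hy => ?_⟩
  obtain ⟨z, hz, hzd⟩ := hFc y hy
  exact Set.mem_iUnion₂.2 ⟨z, hz, hzd.trans_lt hn⟩

theorem map_mem_closure_orbit {g : Fin N → T → T}
    (hg : ∀ i, ∃ c : ℝ≥0, ContractingWith c (g i)) {x y : T} (i : Fin N)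
    (hy : y ∈ closure (orbit g x)) : g i y ∈ closure (orbit g x) := by
  obtain ⟨c, hc⟩ := hg i
  exact map_mem_closure hc.2.continuous hy fun z hz => map_mem_orbit i hz

theorem eq_of_dist_le_dist_map {g : Fin N → T → T}
    (hg : ∀ i, ∃ c : ℝ≥0, ContractingWith c (g i)) {i : Fin N} {s t : T}
    (h : dist s t ≤ dist (g i s) (g i t)) : s = t := by
  obtain ⟨c, -, hc1, hc⟩ := exists_uniform_lipschitz hg
  have h1 := hc i s t
  have h2 : 0 ≤ dist s t := dist_nonneg
  exact dist_le_zero.1 (by nlinarith)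

end Orbits

/-! ### Cuntz representations and their commutants -/

section Representations

variable {N : ℕ}
variable {H : Type*} [NormedAddCommGroup H] [InnerProductSpace ℂ H]

theorem wordOp_cons (S : Fin N → H →L[ℂ] H) (i : Fin N) (ω : List (Fin N)) (x : H) :
    wordOp S (i :: ω) x = S i (wordOp S ω x) := by
  simp [wordOp]

theorem wordOp_nil (S : Fin N → H →L[ℂ] H) (x : H) : wordOp S [] x = x := by
  simp [wordOp]

theorem closure_le_of_isClosed {s : Set H} {L : Submodule ℂ H} (hL : IsClosed (L : Set H))
    (h : s ⊆ L) : (Submodule.span ℂ s).topologicalClosure ≤ L :=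
  Submodule.topologicalClosure_minimal _ (Submodule.span_le.2 h) hL

theorem mem_spaceH {T : Type*} {S : Fin N → H →L[ℂ] H} {f : T → H} {M : Set T} {t : T} (ht : t ∈ M) : f t ∈ spaceH S f M :=
  Submodule.le_topologicalClosure _
    (Submodule.subset_span ⟨t, ht, [], (wordOp_nil S (f t)).symm⟩)

variable [CompleteSpace H]

/-- The operator `X` commutes with all `Sᵢ` and all `Sᵢ*`. -/
def IsInCommutant (S : Fin N → H →L[ℂ] H) (X : H →L[ℂ] H) : Prop :=
  ∀ i x, X (S i x) = S i (X x) ∧ X (adjoint (S i) x) = adjoint (S i) (X x)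

theorem IsInCommutant.one (S : Fin N → H →L[ℂ] H) : IsInCommutant S 1 :=
  fun _ _ => ⟨rfl, rfl⟩

theorem IsInCommutant.smul {S : Fin N → H →L[ℂ] H} {X : H →L[ℂ] H}
    (hX : IsInCommutant S X) (c : ℂ) : IsInCommutant S (c • X) := fun i x => by
  simp [(hX i x).1, (hX i x).2]

theorem IsInCommutant.sub {S : Fin N → H →L[ℂ] H} {X Y : H →L[ℂ] H}
    (hX : IsInCommutant S X) (hY : IsInCommutant S Y) : IsInCommutant S (X - Y) := fun i x => by
  simp [(hX i x).1, (hX i x).2, (hY i x).1, (hY i x).2]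

theorem IsInCommutant.sum {S : Fin N → H →L[ℂ] H} {κ : Type*} (s : Finset κ)
    {X : κ → H →L[ℂ] H} (hX : ∀ j, IsInCommutant S (X j)) :
    IsInCommutant S (∑ j ∈ s, X j) := fun i x => by
  simp only [sum_apply, map_sum]
  exact ⟨Finset.sum_congr rfl fun j _ => (hX j i x).1,
    Finset.sum_congr rfl fun j _ => (hX j i x).2⟩

/-- Invariance under `S i` and under its adjoint exchange roles: each makes the other operator
preserve the orthogonal complement. -/
theorem IsInCommutant.starProjection {S : Fin N → H →L[ℂ] H} {L : Submodule ℂ H}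
    [L.HasOrthogonalProjection] (hL : IsInvariantForRep S L) :
    IsInCommutant S L.starProjection := fun i x => by
  have hx := L.starProjection_apply_mem x
  constructor
  · refine Submodule.eq_starProjection_of_mem_of_inner_eq_zero (hL i _ hx).1 fun w hw => ?_
    rw [← map_sub, ← adjoint_inner_right]
    exact Submodule.starProjection_inner_eq_zero x _ (hL i w hw).2
  · refine Submodule.eq_starProjection_of_mem_of_inner_eq_zero (hL i _ hx).2 fun w hw => ?_
    rw [← map_sub, adjoint_inner_left]
    exact Submodule.starProjection_inner_eq_zero x _ (hL i w hw).1

theorem IsCuntzRep.inner_eq_sum {S : Fin N → H →L[ℂ] H} (hS : IsCuntzRep S) (x y : H) :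
    ⟪x, y⟫_ℂ = ∑ i, ⟪adjoint (S i) x, adjoint (S i) y⟫_ℂ := by
  have h := congrArg (fun Z : H →L[ℂ] H => ⟪x, Z y⟫_ℂ) hS.sum_comp_adjoint
  simp only [sum_apply, inner_sum, comp_apply, id_apply] at h
  rw [← h]
  exact Finset.sum_congr rfl fun i _ => (adjoint_inner_left _ _ _).symm

theorem IsCuntzRep.adjoint_apply_self {S : Fin N → H →L[ℂ] H} (hS : IsCuntzRep S) (i : Fin N)
    (x : H) : adjoint (S i) (S i x) = x :=
  congrArg (fun Z : H →L[ℂ] H => Z x) (hS.adjoint_comp_self i)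

theorem IsCuntzRep.adjoint_apply_of_ne {S : Fin N → H →L[ℂ] H} (hS : IsCuntzRep S) {i j : Fin N}
    (hij : i ≠ j) (x : H) : adjoint (S i) (S j x) = 0 :=
  congrArg (fun Z : H →L[ℂ] H => Z x) (hS.adjoint_comp_of_ne i j hij)

theorem coe_adjoint_subRep {S : Fin N → H →L[ℂ] H} {L : Submodule ℂ H} [CompleteSpace L]
    (hL : IsInvariantForRep S L) (i : Fin N) (x : L) :
    (adjoint (subRep S L hL i) x : H) = adjoint (S i) x := by
  have h : adjoint (subRep S L hL i) x = ⟨adjoint (S i) x, (hL i x x.2).2⟩ := by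
    refine ext_inner_right ℂ fun y => ?_
    rw [adjoint_inner_left, Submodule.coe_inner, Submodule.coe_inner]
    exact (adjoint_inner_left (S i) (y : H) (x : H)).symm
  rw [h]

end Representations

/-! ### The kernel argument and its consequences -/

section Families

variable {N : ℕ} {T : Type*} [MetricSpace T]
variable {H : Type*} [NormedAddCommGroup H] [InnerProductSpace ℂ H] [CompleteSpace H]

/-- A continuous family of unit vectors in the space of a representation of the Cuntz algebra,
on which the `Sᵢ*` act by contractions of the parameter, up to scalars. -/
structure IsContractiveFamily (S : Fin N → H →L[ℂ] H) (f : T → H)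
    (ν : Fin N → T → ℂ) (g : Fin N → T → T) : Prop where
  isCuntzRep : IsCuntzRep S
  continuous : Continuous f
  norm_eq_one : ∀ t, ‖f t‖ = 1
  adjoint_apply : ∀ i t, adjoint (S i) (f t) = ν i t • f (g i t)
  contracting : ∀ i, ∃ c : ℝ≥0, ContractingWith c (g i)

variable {S : Fin N → H →L[ℂ] H} {f : T → H} {ν : Fin N → T → ℂ} {g : Fin N → T → T}

namespace IsContractiveFamily

theorem inner_eq_sum (hf : IsContractiveFamily S f ν g) {X : H →L[ℂ] H}
    (hX : IsInCommutant S X) (s t : T) :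
    ⟪X (f s), f t⟫_ℂ =
      ∑ i, (starRingEnd ℂ) (ν i s) * ν i t * ⟪X (f (g i s)), f (g i t)⟫_ℂ := by
  rw [hf.isCuntzRep.inner_eq_sum]
  refine Finset.sum_congr rfl fun i _ => ?_
  rw [← (hX i _).2, hf.adjoint_apply, hf.adjoint_apply, map_smul, inner_smul_left,
    inner_smul_right, mul_assoc]

theorem norm_sq_eq_sum (hf : IsContractiveFamily S f ν g) {X : H →L[ℂ] H}
    (hX : IsInCommutant S X) (t : T) :
    ‖X (f t)‖ ^ 2 = ∑ i, ‖ν i t‖ ^ 2 * ‖X (f (g i t))‖ ^ 2 := by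
  have h := hf.isCuntzRep.inner_eq_sum (X (f t)) (X (f t))
  simp only [inner_self_eq_norm_sq_to_K] at h
  have h' : ‖X (f t)‖ ^ 2 = ∑ i, ‖adjoint (S i) (X (f t))‖ ^ 2 := by exact_mod_cast h
  rw [h']
  refine Finset.sum_congr rfl fun i _ => ?_
  rw [← (hX i _).2, hf.adjoint_apply, map_smul, norm_smul, mul_pow]

theorem sum_norm_sq (hf : IsContractiveFamily S f ν g) (t : T) :
    ∑ i, ‖ν i t‖ ^ 2 = 1 := by
  have h := hf.norm_sq_eq_sum (IsInCommutant.one S) t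
  simpa [hf.norm_eq_one] using h.symm

theorem exists_ne_zero (hf : IsContractiveFamily S f ν g) (t : T) : ∃ i, ν i t ≠ 0 := by
  by_contra! h
  simpa [h] using hf.sum_norm_sq t

/-- A convex-combination argument: the function `‖⟪X f_s, f_t⟫‖` at a maximum propagates along a
transition that is possible from both `s` and `t`. -/
theorem exists_transition (hf : IsContractiveFamily S f ν g) {X : H →L[ℂ] H}
    (hX : IsInCommutant S X) {s t : T} {m : ℝ} (hm : 0 < m)
    (hst : ‖⟪X (f s), f t⟫_ℂ‖ = m)
    (hle : ∀ i, ν i s ≠ 0 → ν i t ≠ 0 → ‖⟪X (f (g i s)), f (g i t)⟫_ℂ‖ ≤ m) :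
    ∃ i, ν i s ≠ 0 ∧ ν i t ≠ 0 ∧ ‖⟪X (f (g i s)), f (g i t)⟫_ℂ‖ = m := by
  set a : Fin N → ℝ := fun i => ‖ν i s‖ with ha
  set b : Fin N → ℝ := fun i => ‖ν i t‖ with hb
  set u : Fin N → ℝ := fun i => ‖⟪X (f (g i s)), f (g i t)⟫_ℂ‖ with hu
  have hab : ∀ i, a i * b i * u i ≤ a i * b i * m := by
    intro i
    by_cases h1 : ν i s = 0
    · simp [ha, h1]
    by_cases h2 : ν i t = 0
    · simp [hb, h2]
    exact mul_le_mul_of_nonneg_left (hle i h1 h2) (by positivity)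
  have hterm : ∀ i ∈ Finset.univ, 0 ≤ (a i ^ 2 + b i ^ 2) / 2 * m - a i * b i * u i := by
    intro i _
    have := hab i
    nlinarith [sq_nonneg (a i - b i)]
  have hsum : m ≤ ∑ i, a i * b i * u i := by
    rw [← hst, hf.inner_eq_sum hX]
    refine (norm_sum_le _ _).trans_eq (Finset.sum_congr rfl fun i _ => ?_)
    simp [ha, hb, hu]
  -- As `∑ a i ^ 2 = ∑ b i ^ 2 = 1`, the total is at most `m - m`; equality thus holds in every
  -- term.
  have htot : ∑ i, ((a i ^ 2 + b i ^ 2) / 2 * m - a i * b i * u i) = 0 := by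
    refine le_antisymm ?_ (Finset.sum_nonneg hterm)
    rw [Finset.sum_sub_distrib, ← Finset.sum_mul, ← Finset.sum_div, Finset.sum_add_distrib,
      hf.sum_norm_sq, hf.sum_norm_sq]
    linarith
  obtain ⟨i, hi⟩ := hf.exists_ne_zero s
  have h0 := (Finset.sum_eq_zero_iff_of_nonneg hterm).1 htot i (Finset.mem_univ i)
  have hai : 0 < a i := norm_pos_iff.2 hi
  -- If `b i = 0`, the vanishing term would equal `a i ^ 2 / 2 * m > 0`.
  have hbi : ν i t ≠ 0 := by
    intro h
    have : b i = 0 := by simp [hb, h]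
    rw [this] at h0
    nlinarith [mul_pos (pow_pos hai 2) hm]
  have hbi' : 0 < b i := norm_pos_iff.2 hbi
  refine ⟨i, hi, hbi, le_antisymm (hle i hi hbi) ?_⟩
  have hpos : 0 < a i * b i := mul_pos hai hbi'
  have : a i * b i * m ≤ a i * b i * u i := by nlinarith [sq_nonneg (a i - b i)]
  exact le_of_mul_le_mul_left this hpos

theorem inner_eq_zero (hf : IsContractiveFamily S f ν g) {X : H →L[ℂ] H}
    (hX : IsInCommutant S X) {A B : Set T} (hA : IsCompact A) (hB : IsCompact B)
    (hAi : IsInvariantSet ν g A) (hBi : IsInvariantSet ν g B)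
    (hd : ∀ t ∈ A ∩ B, ⟪X (f t), f t⟫_ℂ = 0) {s t : T} (hs : s ∈ A) (ht : t ∈ B) :
    ⟪X (f s), f t⟫_ℂ = 0 := by
  by_contra hne
  have hcont : Continuous fun p : T × T => ‖⟪X (f p.1), f p.2⟫_ℂ‖ :=
    ((X.continuous.comp (hf.continuous.comp continuous_fst)).inner
      (hf.continuous.comp continuous_snd)).norm
  have hAB : IsCompact (A ×ˢ B) := hA.prod hB
  obtain ⟨q, hq, hmax⟩ := hAB.exists_isMaxOn ⟨(s, t), hs, ht⟩ hcont.continuousOn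
  set m := ‖⟪X (f q.1), f q.2⟫_ℂ‖ with hm
  have hm0 : 0 < m := (norm_pos_iff.2 hne).trans_le (hmax (show (s, t) ∈ A ×ˢ B from ⟨hs, ht⟩))
  -- Among the maximizing pairs, one at least distance is taken; a common transition leads to
  -- another maximizing pair, which cannot be closer.
  have hZ : IsCompact ((A ×ˢ B) ∩ {p : T × T | ‖⟪X (f p.1), f p.2⟫_ℂ‖ = m}) :=
    hAB.inter_right (isClosed_eq hcont continuous_const)
  obtain ⟨z, ⟨hz, hzm⟩, hmin⟩ := hZ.exists_isMinOn ⟨q, hq, rfl⟩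
    (continuous_dist (α := T)).continuousOn
  obtain ⟨i, h1, h2, h3⟩ := hf.exists_transition hX hm0 hzm fun i h1 h2 =>
    hmax (show (g i z.1, g i z.2) ∈ A ×ˢ B from ⟨hAi _ hz.1 i h1, hBi _ hz.2 i h2⟩)
  have heq : z.1 = z.2 := eq_of_dist_le_dist_map hf.contracting
    (hmin (show (g i z.1, g i z.2) ∈ _ from ⟨⟨hAi _ hz.1 i h1, hBi _ hz.2 i h2⟩, h3⟩))
  have h0 := hd z.2 ⟨heq ▸ hz.1, hz.2⟩
  have hzm' : ‖⟪X (f z.1), f z.2⟫_ℂ‖ = m := hzm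
  rw [heq, h0, norm_zero] at hzm'
  exact hm0.ne hzm'

/-- The maximum principle: on a compact invariant set, `‖X f_t‖` attains its maximum everywhere
on some minimal compact invariant subset. -/
theorem exists_minimal_isMaxOn (hf : IsContractiveFamily S f ν g) {X : H →L[ℂ] H}
    (hX : IsInCommutant S X) {A : Set T} (hne : A.Nonempty) (hA : IsCompact A)
    (hAi : IsInvariantSet ν g A) :
    ∃ M ∈ minimalCompactInvariantSets ν g, M ⊆ A ∧
      ∀ t ∈ M, IsMaxOn (fun t => ‖X (f t)‖ ^ 2) A t := by
  have hcont : Continuous fun t => ‖X (f t)‖ ^ 2 :=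
    ((X.continuous.comp hf.continuous).norm).pow 2
  obtain ⟨q, hq, hmax⟩ := hA.exists_isMaxOn hne hcont.continuousOn
  -- The level set of the maximum is invariant: the maximal value is an average, with weights
  -- ‖νⱼ(t)‖², of values that do not exceed it.
  obtain ⟨M, hM, hMA⟩ := exists_minimal_subset (ν := ν) (g := g)
    (A := A ∩ {t | ‖X (f t)‖ ^ 2 = ‖X (f q)‖ ^ 2}) ⟨q, hq, rfl⟩
    (hA.inter_right (isClosed_eq hcont continuous_const)) (by
      rintro t ⟨htA, htm⟩ i hi
      refine ⟨hAi t htA i hi, ?_⟩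
      have hterm : ∀ j ∈ Finset.univ,
          0 ≤ ‖ν j t‖ ^ 2 * (‖X (f q)‖ ^ 2 - ‖X (f (g j t))‖ ^ 2) := by
        intro j _
        by_cases hj : ν j t = 0
        · simp [hj]
        · exact mul_nonneg (by positivity) (sub_nonneg.2 (hmax (hAi t htA j hj)))
      have htot : ∑ j, ‖ν j t‖ ^ 2 * (‖X (f q)‖ ^ 2 - ‖X (f (g j t))‖ ^ 2) = 0 := by
        simp only [mul_sub, Finset.sum_sub_distrib]
        rw [← hf.norm_sq_eq_sum hX, ← Finset.sum_mul, hf.sum_norm_sq, one_mul]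
        exact sub_eq_zero.2 (Eq.symm htm)
      have h0 := (Finset.sum_eq_zero_iff_of_nonneg hterm).1 htot i (Finset.mem_univ i)
      rcases mul_eq_zero.1 h0 with h | h
      · exact absurd (by simpa using h) hi
      · exact (sub_eq_zero.1 h).symm)
  refine ⟨M, hM, fun t ht => (hMA ht).1, fun t ht x hx => ?_⟩
  have h1 : ‖X (f t)‖ ^ 2 = ‖X (f q)‖ ^ 2 := (hMA ht).2
  have h2 : ‖X (f x)‖ ^ 2 ≤ ‖X (f q)‖ ^ 2 := hmax hx
  exact h2.trans_eq h1.symm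

theorem apply_eq_zero_of_minimal [CompleteSpace T] (hf : IsContractiveFamily S f ν g)
    {X : H →L[ℂ] H} (hX : IsInCommutant S X)
    (h0 : ∀ M ∈ minimalCompactInvariantSets ν g, ∀ t ∈ M, X (f t) = 0) (t : T) :
    X (f t) = 0 := by
  have htm : t ∈ closure (orbit g t) := subset_closure (mem_orbit_self g t)
  obtain ⟨M, hM, -, hmax⟩ := hf.exists_minimal_isMaxOn hX ⟨t, htm⟩
    (isCompact_closure_orbit hf.contracting t)
    fun x hx i _ => map_mem_closure_orbit hf.contracting i hx
  obtain ⟨x, hx⟩ := (prop_of_minimal hM).1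
  have h : ‖X (f t)‖ ^ 2 ≤ ‖X (f x)‖ ^ 2 := hmax x hx htm
  rw [h0 M hM x hx, norm_zero, zero_pow two_ne_zero] at h
  simpa using le_antisymm h (by positivity)

theorem norm_sq_eq_of_minimal (hf : IsContractiveFamily S f ν g) {X : H →L[ℂ] H}
    (hX : IsInCommutant S X) {M : Set T} (hM : M ∈ minimalCompactInvariantSets ν g)
    {s t : T} (hs : s ∈ M) (ht : t ∈ M) : ‖X (f s)‖ ^ 2 = ‖X (f t)‖ ^ 2 := by
  obtain ⟨M', hM', hsub, hmax⟩ := hf.exists_minimal_isMaxOn hX (prop_of_minimal hM).1 (prop_of_minimal hM).2.1 (prop_of_minimal hM).2.2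
  have hle : M ⊆ M' := subset_of_minimal hM (prop_of_minimal hM') hsub
  exact le_antisymm (hmax t (hle ht) hs) (hmax s (hle hs) ht)

/-- A closest pair between `M` and the orbit closure must coincide. The transition need only be
possible at the point of `M`, since the orbit closure is stable under every `g i`. -/
theorem subset_closure_orbit [CompleteSpace T] (hf : IsContractiveFamily S f ν g) {M : Set T}
    (hM : M ∈ minimalCompactInvariantSets ν g) (x : T) : M ⊆ closure (orbit g x) := by
  have hA := isCompact_closure_orbit hf.contracting x
  have hAi : IsInvariantSet ν g (closure (orbit g x)) :=
    fun y hy i _ => map_mem_closure_orbit hf.contracting i hy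
  obtain ⟨t, ht⟩ := (prop_of_minimal hM).1
  obtain ⟨z, hz, hmin⟩ := ((prop_of_minimal hM).2.1.prod hA).exists_isMinOn
    ⟨(t, x), ht, subset_closure (mem_orbit_self g x)⟩ (continuous_dist (α := T)).continuousOn
  obtain ⟨i, hi⟩ := hf.exists_ne_zero z.1
  have heq : z.1 = z.2 := eq_of_dist_le_dist_map hf.contracting
    (hmin (show (g i z.1, g i z.2) ∈ M ×ˢ closure (orbit g x) from
      ⟨(prop_of_minimal hM).2.2 _ hz.1 i hi, map_mem_closure_orbit hf.contracting i hz.2⟩))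
  exact (subset_of_minimal hM (A := M ∩ closure (orbit g x))
    ⟨⟨z.1, hz.1, heq ▸ hz.2⟩, (prop_of_minimal hM).2.1.inter hA, (prop_of_minimal hM).2.2.inter hAi⟩
    Set.inter_subset_left).trans Set.inter_subset_right

theorem finite_minimal [CompleteSpace T] (hf : IsContractiveFamily S f ν g) :
    (minimalCompactInvariantSets ν g).Finite := by
  by_contra hinf
  let M := Set.Infinite.natEmbedding _ hinf
  choose t ht using fun n => (prop_of_minimal (M n).2).1
  obtain ⟨a, -, φ, hφ, hlim⟩ := (isCompact_closure_orbit hf.contracting (t 0)).tendsto_subseq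
    fun n => hf.subset_closure_orbit (M n).2 (t 0) (ht n)
  have hf1 : Tendsto (fun n => f (t (φ n))) atTop (𝓝 (f a)) :=
    (hf.continuous.tendsto a).comp hlim
  have hf2 : Tendsto (fun n => f (t (φ (n + 1)))) atTop (𝓝 (f a)) :=
    hf1.comp (tendsto_add_atTop_nat 1)
  -- Consecutive terms come from distinct minimal sets; in the limit their orthogonality would give
  -- `f a = 0`.
  have h0 : ∀ n, ⟪f (t (φ n)), f (t (φ (n + 1)))⟫_ℂ = 0 := fun n => by
    have hne : (M (φ n) : Set T) ≠ M (φ (n + 1)) := fun h =>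
      (hφ n.lt_succ_self).ne (M.injective (Subtype.ext h))
    have hdis := disjoint_of_minimal (M (φ n)).2 (M (φ (n + 1))).2 hne
    exact hf.inner_eq_zero (IsInCommutant.one S) (prop_of_minimal (M (φ n)).2).2.1 (prop_of_minimal (M (φ (n + 1))).2).2.1
      (prop_of_minimal (M (φ n)).2).2.2 (prop_of_minimal (M (φ (n + 1))).2).2.2
      (fun x hx => absurd hx.2 (Set.disjoint_left.1 hdis hx.1)) (ht _) (ht _)
  have h := tendsto_nhds_unique ((hf1.inner hf2).congr h0) tendsto_const_nhds
  rw [inner_self_eq_zero] at h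
  simpa [h] using hf.norm_eq_one a

/-! ### The subrepresentations on the spaces H(M) -/

theorem isInvariantForRep_spaceH (hf : IsContractiveFamily S f ν g) {M : Set T}
    (hM : IsInvariantSet ν g M) : IsInvariantForRep S (spaceH S f M) := by
  have hcl : IsClosed (spaceH S f M : Set H) := Submodule.isClosed_topologicalClosure _
  have hw : ∀ t ∈ M, ∀ ω, wordOp S ω (f t) ∈ spaceH S f M := fun t ht ω =>
    Submodule.le_topologicalClosure _ (Submodule.subset_span ⟨t, ht, ω, rfl⟩)
  intro i x hx
  constructor
  · refine closure_le_of_isClosed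
      (L := (spaceH S f M).comap (S i : H →ₗ[ℂ] H)) (hcl.preimage (S i).continuous) ?_ hx
    rintro _ ⟨t, ht, ω, rfl⟩
    have := hw t ht (i :: ω)
    rwa [wordOp_cons] at this
  · refine closure_le_of_isClosed (L := (spaceH S f M).comap (adjoint (S i) : H →ₗ[ℂ] H))
      (hcl.preimage (adjoint (S i)).continuous) ?_ hx
    rintro _ ⟨t, ht, ω, rfl⟩
    change adjoint (S i) (wordOp S ω (f t)) ∈ spaceH S f M
    cases ω with
    | nil =>
      rw [wordOp_nil, hf.adjoint_apply]
      by_cases hi : ν i t = 0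
      · simp [hi]
      · exact Submodule.smul_mem _ _ (mem_spaceH (hM t ht i hi))
    | cons j ω =>
      rw [wordOp_cons]
      by_cases hij : i = j
      · subst hij
        rw [hf.isCuntzRep.adjoint_apply_self]
        exact hw t ht ω
      · rw [hf.isCuntzRep.adjoint_apply_of_ne hij]
        exact Submodule.zero_mem _

theorem inner_apply_spaceH_eq_zero (hf : IsContractiveFamily S f ν g) {X : H →L[ℂ] H}
    (hX : IsInCommutant S X) {A B : Set T} (hA : IsCompact A) (hB : IsCompact B)
    (hAi : IsInvariantSet ν g A) (hBi : IsInvariantSet ν g B)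
    (hd : ∀ t ∈ A ∩ B, ⟪X (f t), f t⟫_ℂ = 0) {x y : H}
    (hx : x ∈ spaceH S f A) (hy : y ∈ spaceH S f B) : ⟪X x, y⟫_ℂ = 0 := by
  have hbase : ∀ s ∈ A, ∀ t ∈ B, ⟪X (f s), f t⟫_ℂ = 0 := fun s hs t ht =>
    hf.inner_eq_zero hX hA hB hAi hBi hd hs ht
  have hleft : ∀ s ∈ A, ∀ y ∈ spaceH S f B, ⟪X (f s), y⟫_ℂ = 0 := by
    suffices h : ∀ ω, ∀ t ∈ B, ∀ s ∈ A, ⟪X (f s), wordOp S ω (f t)⟫_ℂ = 0 by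
      intro s hs y hy
      refine (Submodule.mem_orthogonal_singleton_iff_inner_right).1
        (closure_le_of_isClosed (L := (ℂ ∙ X (f s))ᗮ) (Submodule.isClosed_orthogonal _) ?_ hy)
      rintro _ ⟨t, ht, ω, rfl⟩
      exact (Submodule.mem_orthogonal_singleton_iff_inner_right).2 (h ω t ht s hs)
    -- Moving the first letter across as an adjoint replaces `s` by `g i s`, still in `A` when the
    -- coefficient is nonzero; hence `s` stays general in the induction.
    intro ω t ht
    induction ω with
    | nil => intro s hs; rw [wordOp_nil]; exact hbase s hs t ht
    | cons i ω ih =>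
      intro s hs
      rw [wordOp_cons, ← adjoint_inner_left, ← (hX i _).2, hf.adjoint_apply, map_smul,
        inner_smul_left]
      by_cases hi : ν i s = 0
      · simp [hi]
      · rw [ih _ (hAi s hs i hi), mul_zero]
  suffices h : ∀ ω, ∀ s ∈ A, ∀ y ∈ spaceH S f B, ⟪X (wordOp S ω (f s)), y⟫_ℂ = 0 by
    have := closure_le_of_isClosed (L := (ℂ ∙ y)ᗮ.comap (X : H →ₗ[ℂ] H))
      ((Submodule.isClosed_orthogonal _).preimage X.continuous) (by
        rintro _ ⟨s, hs, ω, rfl⟩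
        exact (Submodule.mem_orthogonal_singleton_iff_inner_left).2 (h ω s hs y hy)) hx
    exact (Submodule.mem_orthogonal_singleton_iff_inner_left).1 this
  -- Here the letter moves onto `y`, which stays general because H(B) is invariant.
  intro ω s hs
  induction ω with
  | nil => intro y hy; rw [wordOp_nil]; exact hleft s hs y hy
  | cons i ω ih =>
    intro y hy
    rw [wordOp_cons, (hX i _).1, ← adjoint_inner_right]
    exact ih _ (hf.isInvariantForRep_spaceH hBi i y hy).2

theorem inner_apply_spaceH_eq_zero_of_ne (hf : IsContractiveFamily S f ν g) {X : H →L[ℂ] H}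
    (hX : IsInCommutant S X) {A B : Set T} (hA : A ∈ minimalCompactInvariantSets ν g)
    (hB : B ∈ minimalCompactInvariantSets ν g) (hne : A ≠ B) {x y : H}
    (hx : x ∈ spaceH S f A) (hy : y ∈ spaceH S f B) : ⟪X x, y⟫_ℂ = 0 :=
  hf.inner_apply_spaceH_eq_zero hX (prop_of_minimal hA).2.1 (prop_of_minimal hB).2.1 (prop_of_minimal hA).2.2 (prop_of_minimal hB).2.2
    (fun _ ht => absurd ht.2 (Set.disjoint_left.1 (disjoint_of_minimal hA hB hne) ht.1)) hx hy

theorem isOrtho_spaceH (hf : IsContractiveFamily S f ν g) {A B : Set T}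
    (hA : A ∈ minimalCompactInvariantSets ν g) (hB : B ∈ minimalCompactInvariantSets ν g)
    (hne : A ≠ B) : spaceH S f A ⟂ spaceH S f B :=
  Submodule.isOrtho_iff_inner_eq.2 fun _ hx _ hy =>
    hf.inner_apply_spaceH_eq_zero_of_ne (IsInCommutant.one S) hA hB hne hx hy

theorem eq_bot_or_spaceH_le (hf : IsContractiveFamily S f ν g) {M : Set T}
    (hM : M ∈ minimalCompactInvariantSets ν g) {L : Submodule ℂ H}
    (hcl : IsClosed (L : Set H)) (hL : IsInvariantForRep S L) (hle : L ≤ spaceH S f M) :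
    L = ⊥ ∨ spaceH S f M ≤ L := by
  have : CompleteSpace L := hcl.completeSpace_coe
  have hP := IsInCommutant.starProjection hL
  obtain ⟨t₀, ht₀⟩ := (prop_of_minimal hM).1
  set c : ℂ := ((‖L.starProjection (f t₀)‖ ^ 2 : ℝ) : ℂ) with hc
  have hQ : IsInCommutant S (L.starProjection - c • 1) := hP.sub ((IsInCommutant.one S).smul c)
  have hQ0 : ∀ x ∈ spaceH S f M, L.starProjection x = c • x := by
    intro x hx
    refine sub_eq_zero.1 (inner_self_eq_zero (𝕜 := ℂ).1 ?_)
    -- The second vector is P_L x - c x itself, which lies in H(M) because `L` does.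
    refine hf.inner_apply_spaceH_eq_zero hQ (prop_of_minimal hM).2.1 (prop_of_minimal hM).2.1 (prop_of_minimal hM).2.2 (prop_of_minimal hM).2.2 ?_ hx
      (Submodule.sub_mem _ (hle (L.starProjection_apply_mem x)) (Submodule.smul_mem _ c hx))
    rintro t ⟨ht, -⟩
    have h1 : ⟪L.starProjection (f t), f t⟫_ℂ = c := by
      have h2 : ⟪L.starProjection (f t), f t - L.starProjection (f t)⟫_ℂ = 0 := by
        rw [← inner_conj_symm, Submodule.starProjection_inner_eq_zero _ _
          (L.starProjection_apply_mem _), map_zero]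
      rw [inner_sub_right, sub_eq_zero, inner_self_eq_norm_sq_to_K] at h2
      rw [h2, hc, ← hf.norm_sq_eq_of_minimal hP hM ht ht₀]
      norm_cast
    have h3 : ⟪f t, f t⟫_ℂ = 1 := by
      rw [inner_self_eq_norm_sq_to_K, hf.norm_eq_one]; simp
    simp only [sub_apply, smul_apply, one_apply_eq_self, inner_sub_left, inner_smul_left, h1, h3]
    simp [hc]
  by_cases hc0 : c = 0
  · left
    refine (Submodule.eq_bot_iff _).2 fun x hx => ?_
    rw [← Submodule.starProjection_eq_self_iff.2 hx, hQ0 x (hle hx), hc0, zero_smul]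
  · right
    intro x hx
    have : c • x ∈ L := hQ0 x hx ▸ L.starProjection_apply_mem x
    exact (Submodule.smul_mem_iff _ hc0).1 this

theorem isIrreducibleRep_subRep (hf : IsContractiveFamily S f ν g) {M : Set T}
    (hM : M ∈ minimalCompactInvariantSets ν g) (hinv : IsInvariantForRep S (spaceH S f M)) :
    IsIrreducibleRep (subRep S (spaceH S f M) hinv) := by
  constructor
  · obtain ⟨t, ht⟩ := (prop_of_minimal hM).1
    refine nontrivial_of_ne (⟨f t, mem_spaceH ht⟩ : spaceH S f M) 0 fun h => ?_
    have h1 : f t = 0 := congrArg Subtype.val h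
    simpa [h1] using hf.norm_eq_one t
  · intro L hcl hL
    have hHcl : IsClosed (spaceH S f M : Set H) := Submodule.isClosed_topologicalClosure _
    have hL' : IsInvariantForRep S (L.map (spaceH S f M).subtype) := by
      rintro i _ ⟨x, hx, rfl⟩
      exact ⟨⟨_, (hL i x hx).1, rfl⟩, ⟨_, (hL i x hx).2, coe_adjoint_subRep hinv i x⟩⟩
    rcases hf.eq_bot_or_spaceH_le hM
      (hHcl.isClosedEmbedding_subtypeVal.isClosedMap (L : Set (spaceH S f M)) hcl) hL'
      (Submodule.map_subtype_le _ _) with h | h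
    · exact Or.inl ((Submodule.eq_bot_iff _).2 fun x hx =>
        Subtype.ext ((Submodule.eq_bot_iff _).1 h x ⟨x, hx, rfl⟩))
    · refine Or.inr ((Submodule.eq_top_iff').2 fun x => ?_)
      obtain ⟨y, hy, hyx⟩ := h x.2
      rwa [← Subtype.ext (show (y : H) = x from hyx)]

theorem areDisjointReps_subRep (hf : IsContractiveFamily S f ν g) {A B : Set T}
    (hA : A ∈ minimalCompactInvariantSets ν g) (hB : B ∈ minimalCompactInvariantSets ν g)
    (hne : A ≠ B) (hAinv : IsInvariantForRep S (spaceH S f A))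
    (hBinv : IsInvariantForRep S (spaceH S f B)) :
    AreDisjointReps (subRep S (spaceH S f A) hAinv) (subRep S (spaceH S f B) hBinv) := by
  intro W hW hW'
  -- `W` extended by zero on the orthogonal complement of H(A).
  let X : H →L[ℂ] H :=
    ((spaceH S f B).subtypeL.comp W).comp (spaceH S f A).orthogonalProjectionOnto
  have hXapp : ∀ x, X x = (W ((spaceH S f A).orthogonalProjectionOnto x) : H) := fun _ => rfl
  have hP := IsInCommutant.starProjection hAinv
  have hX : IsInCommutant S X := by
    intro i x
    have h1 : (spaceH S f A).orthogonalProjectionOnto (S i x) =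
        subRep S _ hAinv i ((spaceH S f A).orthogonalProjectionOnto x) :=
      Subtype.ext (hP i x).1
    have h2 : (spaceH S f A).orthogonalProjectionOnto (adjoint (S i) x) =
        adjoint (subRep S _ hAinv i) ((spaceH S f A).orthogonalProjectionOnto x) :=
      Subtype.ext ((hP i x).2.trans (coe_adjoint_subRep hAinv i _).symm)
    have h3 := congrArg (fun Z => Z ((spaceH S f A).orthogonalProjectionOnto x)) (hW i)
    have h4 := congrArg (fun Z => Z ((spaceH S f A).orthogonalProjectionOnto x)) (hW' i)
    simp only [comp_apply] at h3 h4
    constructor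
    · rw [hXapp, hXapp, h1, h3]; rfl
    · rw [hXapp, hXapp, h2, h4, coe_adjoint_subRep]
  ext x
  have h := hf.inner_apply_spaceH_eq_zero_of_ne hX hA hB hne x.2 (W x).2
  rw [hXapp, Submodule.orthogonalProjectionOnto_mem_subspace_eq_self, inner_self_eq_zero] at h
  exact h

theorem isInternal_spaceH [CompleteSpace T] (hf : IsContractiveFamily S f ν g)
    (hcyc : ∀ L : Submodule ℂ H, IsClosed (L : Set H) → (∀ t, f t ∈ L) →
      IsInvariantForRep S L → L = ⊤)
    {p : ℕ} {M : Fin p → Set T} (hinj : Function.Injective M)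
    (hM : Set.range M = minimalCompactInvariantSets ν g) :
    DirectSum.IsInternal fun j => spaceH S f (M j) := by
  have hmem : ∀ j, M j ∈ minimalCompactInvariantSets ν g := fun j => hM ▸ Set.mem_range_self j
  have hort : ∀ j k, j ≠ k → spaceH S f (M j) ⟂ spaceH S f (M k) := fun j k hjk =>
    hf.isOrtho_spaceH (hmem j) (hmem k) (hinj.ne hjk)
  have hfam : OrthogonalFamily ℂ (fun j => spaceH S f (M j))
      fun j => (spaceH S f (M j)).subtypeₗᵢ :=
    OrthogonalFamily.of_pairwise fun j k hjk => hort j k hjk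
  -- Once `Q = 0`, every vector is a finite sum of its projections, so the direct sum is algebraic
  -- and needs no closure.
  let Q : H →L[ℂ] H := 1 - ∑ j, (spaceH S f (M j)).starProjection
  have hQ : IsInCommutant S Q := (IsInCommutant.one S).sub
    (IsInCommutant.sum _ fun j =>
      IsInCommutant.starProjection (hf.isInvariantForRep_spaceH (prop_of_minimal (hmem j)).2.2))
  have hQf : ∀ t, Q (f t) = 0 := by
    refine hf.apply_eq_zero_of_minimal hQ fun A hA t ht => ?_
    obtain ⟨k, rfl⟩ : A ∈ Set.range M := hM ▸ hA
    have hft := mem_spaceH (S := S) (f := f) ht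
    have : ∑ j, (spaceH S f (M j)).starProjection (f t) = f t := by
      rw [Finset.sum_eq_single k, Submodule.starProjection_eq_self_iff.2 hft]
      · intro j _ hjk
        exact (Submodule.starProjection_apply_eq_zero_iff _).2
          ((hort k j hjk.symm) hft)
      · simp
    simp [Q, sum_apply, this]
  have hker : LinearMap.ker (Q : H →ₗ[ℂ] H) = ⊤ := by
    refine hcyc _ Q.isClosed_ker hQf fun i x hx => ?_
    have hx' : Q x = 0 := hx
    exact ⟨show Q _ = 0 by rw [(hQ i x).1, hx', map_zero],
      show Q _ = 0 by rw [(hQ i x).2, hx', map_zero]⟩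
  rw [DirectSum.isInternal_submodule_iff_iSupIndep_and_iSup_eq_top]
  refine ⟨hfam.independent, (Submodule.eq_top_iff').2 fun x => ?_⟩
  have hx : Q x = 0 := by
    have : x ∈ LinearMap.ker (Q : H →ₗ[ℂ] H) := hker ▸ Submodule.mem_top
    exact this
  have hx' : x = ∑ j, (spaceH S f (M j)).starProjection x := by
    simpa [Q, sum_apply, sub_eq_zero] using hx
  rw [hx']
  exact Submodule.sum_mem _ fun j _ =>
    Submodule.mem_iSup_of_mem j (Submodule.starProjection_apply_mem _ _)

end IsContractiveFamily

end Families

/-! ### Transfer from the row co-isometry to its dilation -/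

section Walks

variable {N : ℕ} {T : Type*} [MetricSpace T]
variable {K : Type*} [NormedAddCommGroup K] [InnerProductSpace ℂ K] [CompleteSpace K]

theorem IsContractiveWalk.isContractiveFamily
    {H : Type*} [NormedAddCommGroup H] [InnerProductSpace ℂ H] [CompleteSpace H]
    {V : Fin N → K →L[ℂ] K} {e : T → K} {ν : Fin N → T → ℂ} {g : Fin N → T → T}
    (he : IsContractiveWalk V e ν g) {ι : K →ₗᵢ[ℂ] H} {S : Fin N → H →L[ℂ] H}
    (hS : IsCuntzDilation V ι S) : IsContractiveFamily S (fun t => ι (e t)) ν g where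
  isCuntzRep := hS.isCuntzRep
  continuous := ι.continuous.comp he.continuous
  norm_eq_one t := by rw [ι.norm_map, he.norm_eq_one]
  adjoint_apply i t := by rw [hS.adjoint_apply, he.adjoint_apply, map_smul]
  contracting := he.contracting

theorem IsContractiveWalk.adjoint_mem_spaceK
    {V : Fin N → K →L[ℂ] K} {e : T → K} {ν : Fin N → T → ℂ} {g : Fin N → T → T}
    (he : IsContractiveWalk V e ν g) {M : Set T} (hM : IsInvariantSet ν g M) (i : Fin N) {x : K}
    (hx : x ∈ spaceK e M) : adjoint (V i) x ∈ spaceK e M := by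
  have hcl : IsClosed (spaceK e M : Set K) := Submodule.isClosed_topologicalClosure _
  refine closure_le_of_isClosed (L := (spaceK e M).comap (adjoint (V i) : K →ₗ[ℂ] K))
    (hcl.preimage (adjoint (V i)).continuous) ?_ hx
  rintro _ ⟨t, ht, rfl⟩
  change adjoint (V i) (e t) ∈ spaceK e M
  rw [he.adjoint_apply]
  by_cases hi : ν i t = 0
  · simp [hi]
  · exact Submodule.smul_mem _ _ (Submodule.le_topologicalClosure _
      (Submodule.subset_span ⟨_, hM t ht i hi, rfl⟩))

end Walks

end CuntzWalk

theorem theorem2p10 {N : ℕ}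
    {K : Type*} [NormedAddCommGroup K] [InnerProductSpace ℂ K] [CompleteSpace K]
    {H : Type*} [NormedAddCommGroup H] [InnerProductSpace ℂ H] [CompleteSpace H]
    {T : Type*} [MetricSpace T] [CompleteSpace T]
    (V : Fin N → K →L[ℂ] K) (hV : CuntzWalk.IsRowCoisometry V)
    (ι : K →ₗᵢ[ℂ] H) (S : Fin N → H →L[ℂ] H) (hS : CuntzWalk.IsCuntzDilation V ι S)
    (e : T → K) (ν : Fin N → T → ℂ) (g : Fin N → T → T)
    (he : CuntzWalk.IsContractiveWalk V e ν g) :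
    (CuntzWalk.minimalCompactInvariantSets ν g).Finite ∧
    ∀ (p : ℕ) (M : Fin p → Set T), Function.Injective M →
      Set.range M = CuntzWalk.minimalCompactInvariantSets ν g →
      (∀ j i, ∀ x ∈ CuntzWalk.spaceK e (M j),
        ContinuousLinearMap.adjoint (V i) x ∈ CuntzWalk.spaceK e (M j)) ∧
      (∀ j k, j ≠ k →
        CuntzWalk.spaceH S (fun t => ι (e t)) (M j) ⟂
          CuntzWalk.spaceH S (fun t => ι (e t)) (M k)) ∧
      DirectSum.IsInternal (fun j => CuntzWalk.spaceH S (fun t => ι (e t)) (M j)) ∧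
      ∃ hinv : ∀ j, CuntzWalk.IsInvariantForRep S
          (CuntzWalk.spaceH S (fun t => ι (e t)) (M j)),
        (∀ j, CuntzWalk.IsIrreducibleRep (CuntzWalk.subRep S _ (hinv j))) ∧
        (∀ j k, j ≠ k → CuntzWalk.AreDisjointReps
          (CuntzWalk.subRep S _ (hinv j)) (CuntzWalk.subRep S _ (hinv k))) := by
  have hf := he.isContractiveFamily hS
  refine ⟨hf.finite_minimal, fun p M hinj hM => ?_⟩
  have hmem : ∀ j, M j ∈ CuntzWalk.minimalCompactInvariantSets ν g :=
    fun j => hM ▸ Set.mem_range_self j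
  refine ⟨fun j i x hx => he.adjoint_mem_spaceK (CuntzWalk.prop_of_minimal (hmem j)).2.2 i hx,
    fun j k hjk => hf.isOrtho_spaceH (hmem j) (hmem k) (hinj.ne hjk),
    hf.isInternal_spaceH (fun L hcl hL hinv => hS.cyclic L hcl (fun k => ?_) hinv) hinj hM,
    fun j => hf.isInvariantForRep_spaceH (CuntzWalk.prop_of_minimal (hmem j)).2.2,
    fun j => hf.isIrreducibleRep_subRep (hmem j) _,
    fun j k hjk => hf.areDisjointReps_subRep (hmem j) (hmem k) (hinj.ne hjk) _ _⟩
  -- Cyclicity is stated for all of `K`; a closed subspace containing every `ι (e t)` contains `ι K`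
  -- by density of the span.
  refine CuntzWalk.closure_le_of_isClosed (s := Set.range e) (L := L.comap (ι : K →ₗ[ℂ] H))
    (hcl.preimage ι.continuous) ?_ (he.span_dense ▸ Submodule.mem_top)
  rintro _ ⟨t, rfl⟩
  exact hL t
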